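/- Let $A$ be an arbitrary set (possibly uncountable) and let $w=(w_n)_{n\ge 0}\in c_0\setminus\ell_1$ be a sequence of strictly positive real numbers with $w_0=1$. Let $X=d_*(w,1,A)$ be the predual of the Lorentz sequence space $d(w,1,A)$, that is, the space of all functions $y:A\to\mathbb{R}$ for which the sequence $\overline{y}=(\overline{y}_k)_{k\ge 1}$ given by $$\overline{y}_k=\sup\left\{\frac{\sum_{i=0}^{k-1}|y(a_i)|}{\sum_{i=0}^{k-1}w_i} : a_0,\dots,a_{k-1}\text{ are distinct points of }A\right\}$$ (with $\overline{y}_k=0$ if $A$ has fewer than $k$ points) belongs to $c_0$, equipped with the norm $\|y\|=\|\overline{y}\|_\infty$. Then for every $\varepsilon>0$ there is an equivalent norm $|||\cdot|||$ on $X$ which is $C^\infty$ smooth, i.e. has continuous Fréchet derivatives of every order on $X\setminus\{0\}$, and which $\varepsilon$-approximates $\|\cdot\|$, i.e. $$(1-\varepsilon)\|x\|\le |||x|||\le(1+\varepsilon)\|x\|\qquad\text{for all }x\in X.$$ -/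

import Mathlib

open Filter Topology
open scoped ContDiff

/-- A weight sequence `w ∈ c₀ \ ℓ₁` with strictly positive terms and `w 0 = 1`. -/
structure LorentzWeight where
  /-- the terms of the sequence -/
  seq : ℕ → ℝ
  pos : ∀ n, 0 < seq n
  zero_eq_one : seq 0 = 1
  tendsto_zero : Tendsto seq atTop (𝓝 0)
  not_summable : ¬ Summable seq

namespace LorentzWeight

/-- The partial sum `w 0 + ⋯ + w (k - 1)`. -/
def partialSum (w : LorentzWeight) (k : ℕ) : ℝ := ∑ i ∈ Finset.range k, w.seq i

lemma partialSum_succ_pos (w : LorentzWeight) (k : ℕ) : 0 < w.partialSum (k + 1) :=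
  Finset.sum_pos (fun i _ => w.pos i) ⟨0, by simp⟩

end LorentzWeight

namespace Lorentz

variable {A : Type*}

/-- The quotients `(|y a₀| + ⋯ + |y aₖ|) / (w 0 + ⋯ + w k)`, where `a₀, …, aₖ` run over all
choices of `k + 1` distinct points of `A`. This set is empty if `A` has at most `k` points. -/
def quotients (w : LorentzWeight) (y : A → ℝ) (k : ℕ) : Set ℝ :=
  {r | ∃ s : Finset A, s.card = k + 1 ∧ r = (∑ a ∈ s, |y a|) / w.partialSum (k + 1)}

/-- The supremum of `quotients w y k`, i.e. the term with index `k + 1` (that is, the term for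
`k + 1` points) of the sequence `ȳ`. It is `0` if `A` has at most `k` points. -/
noncomputable def bar (w : LorentzWeight) (y : A → ℝ) (k : ℕ) : ℝ := sSup (quotients w y k)

/-- `ȳ ∈ c₀`: all terms of `ȳ` are finite and they tend to `0`. -/
def BarMemC0 (w : LorentzWeight) (y : A → ℝ) : Prop :=
  (∀ k, BddAbove (quotients w y k)) ∧ Tendsto (bar w y) atTop (𝓝 0)

lemma quotients_nonneg (w : LorentzWeight) (y : A → ℝ) (k : ℕ) :
    ∀ r ∈ quotients w y k, 0 ≤ r := by
  rintro r ⟨s, -, rfl⟩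
  exact div_nonneg (Finset.sum_nonneg fun a _ => abs_nonneg _) (w.partialSum_succ_pos k).le

lemma bar_nonneg (w : LorentzWeight) (y : A → ℝ) (k : ℕ) : 0 ≤ bar w y k :=
  Real.sSup_nonneg (quotients_nonneg w y k)

lemma quotients_add_le {w : LorentzWeight} {x y : A → ℝ} {k : ℕ}
    (hx : BddAbove (quotients w x k)) (hy : BddAbove (quotients w y k)) :
    ∀ r ∈ quotients w (x + y) k, r ≤ bar w x k + bar w y k := by
  rintro r ⟨s, hs, rfl⟩
  have h1 := le_csSup hx ⟨s, hs, rfl⟩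
  have h2 := le_csSup hy ⟨s, hs, rfl⟩
  refine le_trans ?_ (add_le_add h1 h2)
  rw [← add_div, ← Finset.sum_add_distrib]
  refine div_le_div_of_nonneg_right ?_ (w.partialSum_succ_pos k).le
  exact Finset.sum_le_sum fun a _ => abs_add_le _ _

lemma bar_add_le {w : LorentzWeight} {x y : A → ℝ} {k : ℕ}
    (hx : BddAbove (quotients w x k)) (hy : BddAbove (quotients w y k)) :
    bar w (x + y) k ≤ bar w x k + bar w y k :=
  Real.sSup_le (quotients_add_le hx hy) (add_nonneg (bar_nonneg w x k) (bar_nonneg w y k))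

open scoped Pointwise in
lemma quotients_smul (w : LorentzWeight) (c : ℝ) (y : A → ℝ) (k : ℕ) :
    quotients w (c • y) k = |c| • quotients w y k := by
  have key : ∀ s : Finset A, (∑ a ∈ s, |(c • y) a|) / w.partialSum (k + 1)
      = |c| * ((∑ a ∈ s, |y a|) / w.partialSum (k + 1)) := by
    intro s
    simp [abs_mul, ← Finset.mul_sum, mul_div_assoc]
  ext r
  rw [Set.mem_smul_set]
  constructor
  · rintro ⟨s, hs, rfl⟩
    exact ⟨_, ⟨s, hs, rfl⟩, (key s).symm⟩
  · rintro ⟨_, ⟨s, hs, rfl⟩, rfl⟩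
    exact ⟨s, hs, (key s).symm⟩

lemma bar_smul (w : LorentzWeight) (c : ℝ) (y : A → ℝ) (k : ℕ) :
    bar w (c • y) k = |c| * bar w y k := by
  rw [bar, quotients_smul, Real.sSup_smul_of_nonneg (abs_nonneg c), smul_eq_mul, bar]

lemma bar_zero (w : LorentzWeight) (k : ℕ) : bar w (0 : A → ℝ) k = 0 := by
  simpa using bar_smul w 0 (0 : A → ℝ) k

/-- The linear space of all `y : A → ℝ` with `ȳ ∈ c₀`. -/
def predualSubmodule (w : LorentzWeight) (A : Type*) : Submodule ℝ (A → ℝ) where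
  carrier := {y | BarMemC0 w y}
  zero_mem' := by
    refine ⟨fun k => ⟨0, ?_⟩, ?_⟩
    · rintro r ⟨s, -, rfl⟩
      simp
    · have : bar w (0 : A → ℝ) = fun _ => 0 := funext (bar_zero w)
      rw [this]
      exact tendsto_const_nhds
  add_mem' := by
    rintro x y ⟨hx, hx'⟩ ⟨hy, hy'⟩
    refine ⟨fun k => ⟨_, quotients_add_le (hx k) (hy k)⟩, ?_⟩
    refine squeeze_zero (bar_nonneg w _) (fun k => bar_add_le (hx k) (hy k)) ?_
    simpa using hx'.add hy'
  smul_mem' := by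
    rintro c y ⟨hy, hy'⟩
    refine ⟨fun k => ?_, ?_⟩
    · rw [quotients_smul]
      exact (hy k).smul_of_nonneg (abs_nonneg c)
    · have : bar w (c • y) = fun k => |c| * bar w y k := funext (bar_smul w c y)
      rw [this]
      simpa using hy'.const_mul |c|

end Lorentz

/-- The predual `d_*(w, 1, A)` of the Lorentz sequence space `d(w, 1, A)`: the space of all
`y : A → ℝ` with `ȳ ∈ c₀`. It is a type of its own, so that it does not inherit the topology of
pointwise convergence from `A → ℝ`. -/
def LorentzPredual (w : LorentzWeight) (A : Type*) : Type _ := Lorentz.predualSubmodule w A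

namespace LorentzPredual

variable {w : LorentzWeight} {A : Type*}

noncomputable instance : AddCommGroup (LorentzPredual w A) :=
  inferInstanceAs (AddCommGroup (Lorentz.predualSubmodule w A))

noncomputable instance : Module ℝ (LorentzPredual w A) :=
  inferInstanceAs (Module ℝ (Lorentz.predualSubmodule w A))

/-- The function `A → ℝ` underlying an element of `d_*(w, 1, A)`. -/
def toFun (y : LorentzPredual w A) : A → ℝ := y.1

/-- The norm `‖y‖ = ‖ȳ‖_∞`. -/
noncomputable instance : Norm (LorentzPredual w A) := ⟨fun y => ⨆ k, Lorentz.bar w y.toFun k⟩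

lemma norm_def (y : LorentzPredual w A) : ‖y‖ = ⨆ k, Lorentz.bar w y.toFun k := rfl

lemma bddAbove_bar (y : LorentzPredual w A) : BddAbove (Set.range (Lorentz.bar w y.toFun)) :=
  y.2.2.bddAbove_range

lemma bar_le_norm (y : LorentzPredual w A) (k : ℕ) : Lorentz.bar w y.toFun k ≤ ‖y‖ :=
  le_ciSup y.bddAbove_bar k

lemma abs_apply_le_norm (y : LorentzPredual w A) (a : A) : |y.toFun a| ≤ ‖y‖ := by
  refine le_trans ?_ (y.bar_le_norm 0)
  refine le_csSup (y.2.1 0) ⟨{a}, by simp, ?_⟩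
  simp [LorentzWeight.partialSum, w.zero_eq_one]

lemma normedSpaceCore : NormedSpace.Core ℝ (LorentzPredual w A) where
  norm_nonneg y := Real.iSup_nonneg fun k => Lorentz.bar_nonneg w y.toFun k
  norm_smul c y := by
    rw [norm_def, norm_def, Real.norm_eq_abs, Real.mul_iSup_of_nonneg (abs_nonneg c)]
    exact congrArg iSup (funext (Lorentz.bar_smul w c y.toFun))
  norm_triangle x y := ciSup_le fun k =>
    (Lorentz.bar_add_le (x.2.1 k) (y.2.1 k)).trans
      (add_le_add (x.bar_le_norm k) (y.bar_le_norm k))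
  norm_eq_zero_iff y := by
    constructor
    · intro h
      refine Subtype.ext (funext fun a => ?_)
      have := y.abs_apply_le_norm a
      rw [h] at this
      exact abs_nonpos_iff.mp this
    · rintro rfl
      have : Lorentz.bar w (0 : LorentzPredual w A).toFun = fun _ => 0 :=
        funext (Lorentz.bar_zero w)
      rw [norm_def, this]
      simp

noncomputable instance : NormedAddCommGroup (LorentzPredual w A) :=
  NormedAddCommGroup.ofCore normedSpaceCore

noncomputable instance : NormedSpace ℝ (LorentzPredual w A) :=
  NormedSpace.ofCore normedSpaceCore

end LorentzPredual

section Renorming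

variable {X : Type*} [NormedAddCommGroup X] [NormedSpace ℝ X]

/-- `N` is an equivalent norm on `X`. The lower bound makes the seminorm `N` a norm. -/
def IsEquivalentNorm (N : Seminorm ℝ X) : Prop :=
  ∃ c C : ℝ, 0 < c ∧ 0 < C ∧ ∀ x, c * ‖x‖ ≤ N x ∧ N x ≤ C * ‖x‖

/-- `N` is `C^∞` smooth: on `X \ {0}` it has continuous Fréchet derivatives of all orders. -/
def IsSmoothNorm (N : Seminorm ℝ X) : Prop :=
  ContDiffOn ℝ ∞ N {x : X | x ≠ 0}

/-- `N` `ε`-approximates the norm of `X`. -/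
def EpsApproximates (ε : ℝ) (N : Seminorm ℝ X) : Prop :=
  ∀ x, (1 - ε) * ‖x‖ ≤ N x ∧ N x ≤ (1 + ε) * ‖x‖

end Renorming

/-! Write `W m` for the sum of the first `m` weights. The norm is the supremum of `ℓ i y / W m` over
finitely supported sign patterns `i` of size `m ≥ 1`, where `ℓ i` is the signed sum. The unit ball
is replaced by the set where all finite sums of `φ i (ℓ i y)` are at most `1`; here `φ i` is smooth,
convex, zero up to `W m`, and exceeds `1` from a level just above `W m` on. This set lies between
the balls of radius `1` and `1 + ε`, and its gauge is the new norm.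

Smoothness rests on local finiteness (`locallyFinite_profile`). If a pattern `i` is active near a
point `y` of the set, then `ℓ i y` nearly exceeds `W` of its size, and `ȳ → 0` bounds that size. If
the pattern used a point where `y` is small, deleting such points would barely change the sum but
lower the size to some `m`. The sum would then almost reach `W (m + 1)`, hence exceed the level of
`m`, which is impossible in the set. So active patterns live on the finite set where `y` is not
small.

Near a boundary point the gauge thus depends on finitely many functionals, and the implicit function
theorem applies (`contDiffAt_gauge_sumSublevel`). -/

/-! ### Smooth gauges from locally finite sums of convex functions -/

section GaugeOfSums

variable {X : Type*} [NormedAddCommGroup X] [NormedSpace ℝ X] {ι : Type*}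

/-- The set where all finite partial sums of the family `φ i ∘ ℓ i` are at most `1`. -/
def sumSublevel (φ : ι → ℝ → ℝ) (ℓ : ι → X →L[ℝ] ℝ) : Set X :=
  {y | ∀ F : Finset ι, ∑ i ∈ F, φ i (ℓ i y) ≤ 1}

variable {φ : ι → ℝ → ℝ} {ℓ : ι → X →L[ℝ] ℝ}

lemma convexOn_sum_comp (hconv : ∀ i, ConvexOn ℝ Set.univ (φ i)) (F : Finset ι) :
    ConvexOn ℝ Set.univ fun y => ∑ i ∈ F, φ i (ℓ i y) := by
  have h : ∀ i, ConvexOn ℝ Set.univ fun y => φ i (ℓ i y) := fun i => by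
    simpa [Function.comp_def] using (hconv i).comp_linearMap (ℓ i : X →ₗ[ℝ] ℝ)
  classical
  induction F using Finset.induction_on with
  | empty => simpa using convexOn_const (0 : ℝ) convex_univ
  | insert i F hi ih =>
    simp only [Finset.sum_insert hi]
    exact (h i).add ih

lemma convex_sumSublevel (hconv : ∀ i, ConvexOn ℝ Set.univ (φ i)) :
    Convex ℝ (sumSublevel φ ℓ) := by
  have : sumSublevel φ ℓ = ⋂ F : Finset ι, {y | ∑ i ∈ F, φ i (ℓ i y) ≤ 1} := by
    ext y; simp [sumSublevel]
  rw [this]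
  refine convex_iInter fun F => ?_
  simpa using (convexOn_sum_comp hconv F).convex_le 1

lemma isClosed_sumSublevel (hφ : ∀ i, Continuous (φ i)) : IsClosed (sumSublevel φ ℓ) := by
  have : sumSublevel φ ℓ = ⋂ F : Finset ι, {y | ∑ i ∈ F, φ i (ℓ i y) ≤ 1} := by
    ext y; simp [sumSublevel]
  rw [this]
  refine isClosed_iInter fun F => isClosed_le ?_ continuous_const
  exact continuous_finsetSum _ fun i _ => (hφ i).comp (ℓ i).continuous

lemma mem_sumSublevel_iff (hnn : ∀ i t, 0 ≤ φ i t) {F : Finset ι} {z : X}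
    (hz : ∀ i ∉ F, φ i (ℓ i z) = 0) :
    z ∈ sumSublevel φ ℓ ↔ ∑ i ∈ F, φ i (ℓ i z) ≤ 1 := by
  classical
  refine ⟨fun h => h F, fun h G => le_trans ?_ h⟩
  calc ∑ i ∈ G, φ i (ℓ i z) ≤ ∑ i ∈ G ∪ F, φ i (ℓ i z) :=
        Finset.sum_le_sum_of_subset_of_nonneg Finset.subset_union_left fun i _ _ => hnn _ _
    _ = ∑ i ∈ F, φ i (ℓ i z) :=
        (Finset.sum_subset Finset.subset_union_right fun i _ hi => hz i hi).symm

/-- Near a point where the family is locally finite, the level set `∑ φ i (ℓ i z) = 1` lies in the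
frontier. -/
lemma mem_frontier_sumSublevel (hconv : ∀ i, ConvexOn ℝ Set.univ (φ i))
    (hcont : ∀ i, Continuous (φ i)) (hnn : ∀ i t, 0 ≤ φ i t) (h0 : ∀ i, φ i 0 = 0)
    {F : Finset ι} {z : X} (hz : ∀ i ∉ F, φ i (ℓ i z) = 0) :
    ∑ i ∈ F, φ i (ℓ i z) = 1 → z ∈ frontier (sumSublevel φ ℓ) := by
  intro h1
  have hzC : z ∈ sumSublevel φ ℓ := (mem_sumSublevel_iff hnn hz).2 h1.le
  rw [(isClosed_sumSublevel hcont).frontier_eq]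
  refine ⟨hzC, fun hint => ?_⟩
  -- If `z` were interior, some `s • z` with `s > 1` would lie in the set; convexity between `0` and
  -- `s • z` then bounds the sum at `z` by `s⁻¹ < 1`.
  have hlim : Tendsto (fun s : ℝ => s • z) (𝓝[>] 1) (𝓝 z) := by
    have : Tendsto (fun s : ℝ => s • z) (𝓝 1) (𝓝 ((1 : ℝ) • z)) :=
      (continuous_id.smul continuous_const).tendsto 1
    rw [one_smul] at this
    exact this.mono_left nhdsWithin_le_nhds
  obtain ⟨s, hs, hs1⟩ :=
    ((hlim.eventually (mem_interior_iff_mem_nhds.1 hint)).and self_mem_nhdsWithin).exists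
  have hs1 : 1 < s := hs1
  have hs0 : 0 < s := by linarith
  have hle := hs F
  have hc := (convexOn_sum_comp (ℓ := ℓ) hconv F).2 (Set.mem_univ (s • z)) (Set.mem_univ 0)
    (inv_nonneg.2 hs0.le) (sub_nonneg.2 (inv_le_one_of_one_le₀ hs1.le)) (add_sub_cancel _ _)
  simp only [smul_zero, add_zero, smul_smul, inv_mul_cancel₀ hs0.ne', one_smul, map_zero, h0,
    Finset.sum_const_zero, smul_eq_mul, mul_zero, h1] at hc
  have : s⁻¹ * ∑ i ∈ F, φ i (ℓ i (s • z)) ≤ s⁻¹ * 1 :=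
    mul_le_mul_of_nonneg_left hle (by positivity)
  have := inv_lt_one_of_one_lt₀ hs1
  linarith

lemma sum_eq_one_of_mem_frontier (hcont : ∀ i, Continuous (φ i)) (hnn : ∀ i t, 0 ≤ φ i t)
    {F : Finset ι} {y : X} (hy : y ∈ frontier (sumSublevel φ ℓ))
    (hF : ∀ᶠ z in 𝓝 y, ∀ i ∉ F, φ i (ℓ i z) = 0) : ∑ i ∈ F, φ i (ℓ i y) = 1 := by
  rw [(isClosed_sumSublevel hcont).frontier_eq] at hy
  refine le_antisymm (hy.1 F) (not_lt.1 fun hlt => hy.2 ?_)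
  have hc : Continuous fun z => ∑ i ∈ F, φ i (ℓ i z) :=
    continuous_finsetSum _ fun i _ => (hcont i).comp (ℓ i).continuous
  rw [mem_interior_iff_mem_nhds]
  filter_upwards [hF, hc.continuousAt.eventually_lt_const hlt] with z hz hz1
  exact (mem_sumSublevel_iff hnn hz).2 hz1.le

/-- A convex function of one variable that is smaller at `0` than at `u > 0` has positive
derivative at `u`. -/
lemma ConvexOn.deriv_pos_of_lt {g : ℝ → ℝ} {u d : ℝ} (hg : ConvexOn ℝ Set.univ g) (hu : 0 < u)
    (hd : HasDerivAt g d u) (hlt : g 0 < g u) : 0 < d := by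
  have h := hg.slope_le_of_hasDerivAt (Set.mem_univ 0) (Set.mem_univ u) hu hd
  refine lt_of_lt_of_le ?_ h
  rw [slope_def_field]
  exact div_pos (by linarith) (by linarith)

/-- The implicit equation `∑ φ i (u * v i) = 1` has a smooth solution `u` near a given one. -/
lemma exists_smooth_radial_solution {κ : Type*} [Fintype κ] {φ : κ → ℝ → ℝ}
    (hconv : ∀ i, ConvexOn ℝ Set.univ (φ i)) (hsm : ∀ i, ContDiff ℝ ∞ (φ i))
    (h0 : ∀ i, φ i 0 = 0) {v₀ : κ → ℝ} {u₀ : ℝ} (hu₀ : 0 < u₀)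
    (h1 : ∑ i, φ i (u₀ * v₀ i) = 1) :
    ∃ ψ : (κ → ℝ) → ℝ, ψ v₀ = u₀ ∧ ContDiffAt ℝ ∞ ψ v₀ ∧
      ∀ᶠ v in 𝓝 v₀, ∑ i, φ i (ψ v * v i) = 1 := by
  set f : (κ → ℝ) × ℝ → ℝ := fun p => ∑ i, φ i (p.2 * p.1 i) with hf
  have hfs : ContDiff ℝ ∞ f := by
    refine ContDiff.sum fun i _ => (hsm i).comp ?_
    fun_prop
  have hfd : HasFDerivAt f (fderiv ℝ f (v₀, u₀)) (v₀, u₀) :=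
    (hfs.differentiable (by simp) _).hasFDerivAt
  have hline : HasDerivAt (fun t => f (v₀, t)) (fderiv ℝ f (v₀, u₀) (0, 1)) u₀ :=
    hfd.comp_hasDerivAt u₀ ((hasDerivAt_const u₀ v₀).prodMk (hasDerivAt_id u₀))
  have hcv : ConvexOn ℝ Set.univ fun t => f (v₀, t) := by
    have := convexOn_sum_comp (ℓ := fun i => (v₀ i) • ContinuousLinearMap.id ℝ ℝ) hconv Finset.univ
    simpa [hf, mul_comm] using this
  -- The radial function is convex, `0` at `0` and `1` at `u₀`, so its derivative at `u₀` is
  -- nonzero, as the implicit function theorem requires.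
  have hpos : 0 < fderiv ℝ f (v₀, u₀) (0, 1) := by
    refine hcv.deriv_pos_of_lt hu₀ hline ?_
    simp only [hf, zero_mul, h0, Finset.sum_const_zero, h1, zero_lt_one]
  have hinv : (fderiv ℝ f (v₀, u₀) ∘L .inr ℝ (κ → ℝ) ℝ).IsInvertible := by
    refine ⟨ContinuousLinearEquiv.unitsEquivAut ℝ (Units.mk0 _ hpos.ne'), ?_⟩
    ext
    simp
  have hfa : ContDiffAt ℝ ∞ f (v₀, u₀) := hfs.contDiffAt
  refine ⟨hfa.implicitFunction (by simp) hinv, hfa.implicitFunction_apply_self (by simp) hinv,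
    hfa.contDiffAt_implicitFunction (by simp) hinv, ?_⟩
  filter_upwards [hfa.eventually_apply_implicitFunction (by simp) hinv] with v hv
  exact hv.trans h1

/-- The gauge of `sumSublevel φ ℓ` is smooth away from its zeros if the family `φ i ∘ ℓ i` is
locally finite at the points of this set. -/
theorem contDiffAt_gauge_sumSublevel (hconv : ∀ i, ConvexOn ℝ Set.univ (φ i))
    (hsm : ∀ i, ContDiff ℝ ∞ (φ i)) (hnn : ∀ i t, 0 ≤ φ i t) (h0 : ∀ i, φ i 0 = 0)
    (hnhds : sumSublevel φ ℓ ∈ 𝓝 0)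
    (hfin : ∀ y ∈ sumSublevel φ ℓ, ∃ F : Finset ι, ∀ᶠ z in 𝓝 y, ∀ i ∉ F, φ i (ℓ i z) = 0)
    {x : X} (hx : 0 < gauge (sumSublevel φ ℓ) x) :
    ContDiffAt ℝ ∞ (gauge (sumSublevel φ ℓ)) x := by
  set C := sumSublevel φ ℓ with hC
  have hcont : ∀ i, Continuous (φ i) := fun i => (hsm i).continuous
  have hcvx : Convex ℝ C := convex_sumSublevel hconv
  set u₀ := (gauge C x)⁻¹ with hu
  have hu₀ : 0 < u₀ := inv_pos.2 hx
  have hy : u₀ • x ∈ frontier C := by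
    rw [← gauge_eq_one_iff_mem_frontier hcvx hnhds, gauge_smul_of_nonneg hu₀.le, smul_eq_mul,
      inv_mul_cancel₀ hx.ne']
  obtain ⟨F, hF⟩ := hfin (u₀ • x) ((isClosed_sumSublevel hcont).frontier_subset hy)
  have hsum := sum_eq_one_of_mem_frontier hcont hnn hy hF
  -- The equation factors through the finite-dimensional `F → ℝ`, so completeness of `X` is not
  -- needed.
  let L : X →L[ℝ] (F → ℝ) := ContinuousLinearMap.pi fun i => ℓ i
  have hsumF : ∀ (u : ℝ) (z : X),
      ∑ i : F, φ i (u * L z i) = ∑ i ∈ F, φ i (ℓ i (u • z)) := fun u z => by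
    rw [← Finset.sum_coe_sort F fun i => φ i (ℓ i (u • z))]
    simp [L]
  obtain ⟨ψ, hψ0, hψ, hψ1⟩ := exists_smooth_radial_solution (κ := F) (φ := fun i => φ i)
    (fun i => hconv i) (fun i => hsm i) (fun i => h0 i) (v₀ := L x) hu₀ ((hsumF u₀ x).trans hsum)
  have hcomp : ContDiffAt ℝ ∞ (fun z => ψ (L z)) x := hψ.comp x L.contDiff.contDiffAt
  have hsmul : Tendsto (fun z => ψ (L z) • z) (𝓝 x) (𝓝 (u₀ • x)) := by
    have : ContinuousAt (fun z => ψ (L z) • z) x := hcomp.continuousAt.smul continuousAt_id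
    simpa [ContinuousAt, hψ0] using this
  have hpos : ∀ᶠ z in 𝓝 x, 0 < ψ (L z) :=
    hcomp.continuousAt.eventually_const_lt (by simpa [hψ0] using hu₀)
  -- `ψ (L z) • z` lies on the frontier, so the gauge at `z` is `(ψ (L z))⁻¹`.
  refine (hcomp.inv (by simpa [hψ0] using hu₀.ne')).congr_of_eventuallyEq ?_
  filter_upwards [hpos, hsmul.eventually hF, L.continuous.continuousAt.eventually hψ1]
    with z hz hzF hz1
  have hfr := mem_frontier_sumSublevel hconv hcont hnn h0 hzF ((hsumF _ z).symm.trans hz1)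
  rw [← hC, ← gauge_eq_one_iff_mem_frontier hcvx hnhds, gauge_smul_of_nonneg hz.le,
    smul_eq_mul] at hfr
  exact eq_inv_of_mul_eq_one_right hfr

end GaugeOfSums

/-! ### Smooth convex ramps -/

section Ramp

/-- A smooth convex function that vanishes exactly on `(-∞, 0]`. -/
noncomputable def smoothHinge (x : ℝ) : ℝ := ∫ t in (0 : ℝ)..x, expNegInvGlue t

lemma continuous_expNegInvGlue : Continuous expNegInvGlue :=
  (expNegInvGlue.contDiff (n := 0)).continuous

lemma hasDerivAt_smoothHinge (x : ℝ) : HasDerivAt smoothHinge (expNegInvGlue x) x :=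
  continuous_expNegInvGlue.integral_hasStrictDerivAt 0 x |>.hasDerivAt

lemma deriv_smoothHinge : deriv smoothHinge = expNegInvGlue :=
  funext fun x => (hasDerivAt_smoothHinge x).deriv

lemma differentiable_smoothHinge : Differentiable ℝ smoothHinge := fun x =>
  (hasDerivAt_smoothHinge x).differentiableAt

lemma contDiff_smoothHinge : ContDiff ℝ ∞ smoothHinge :=
  contDiff_infty_iff_deriv.2
    ⟨differentiable_smoothHinge, deriv_smoothHinge ▸ expNegInvGlue.contDiff⟩

lemma convexOn_smoothHinge : ConvexOn ℝ Set.univ smoothHinge :=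
  Monotone.convexOn_univ_of_deriv differentiable_smoothHinge
    (deriv_smoothHinge ▸ expNegInvGlue.monotone)

lemma monotone_smoothHinge : Monotone smoothHinge :=
  monotone_of_deriv_nonneg differentiable_smoothHinge fun x => by
    rw [deriv_smoothHinge]; exact expNegInvGlue.nonneg x

lemma smoothHinge_of_nonpos {x : ℝ} (hx : x ≤ 0) : smoothHinge x = 0 := by
  rw [smoothHinge, intervalIntegral.integral_congr (g := fun _ => (0 : ℝ)) fun t ht => ?_]
  · simp
  · rw [Set.uIcc_of_ge hx] at ht
    exact expNegInvGlue.zero_of_nonpos ht.2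

lemma smoothHinge_pos {x : ℝ} (hx : 0 < x) : 0 < smoothHinge x :=
  intervalIntegral.intervalIntegral_pos_of_pos_on
    (continuous_expNegInvGlue.intervalIntegrable _ _)
    (fun _ ht => expNegInvGlue.pos_of_pos ht.1) hx

lemma smoothHinge_nonneg (x : ℝ) : 0 ≤ smoothHinge x := by
  rcases le_or_gt x 0 with h | h
  · exact (smoothHinge_of_nonpos h).ge
  · exact (smoothHinge_pos h).le

/-- A smooth convex function that vanishes on `(-∞, a]` and is greater than `1` on `[b, ∞)`. -/
noncomputable def smoothRamp (a b t : ℝ) : ℝ := 2 / smoothHinge (b - a) * smoothHinge (t - a)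

lemma contDiff_smoothRamp (a b : ℝ) : ContDiff ℝ ∞ (smoothRamp a b) :=
  contDiff_const.mul (contDiff_smoothHinge.comp (contDiff_id.sub contDiff_const))

lemma convexOn_smoothRamp (a b : ℝ) : ConvexOn ℝ Set.univ (smoothRamp a b) := by
  have h := (convexOn_smoothHinge.translate_left (-a)).smul
    (c := 2 / smoothHinge (b - a)) (div_nonneg zero_le_two (smoothHinge_nonneg _))
  refine (Set.preimage_univ ▸ h).congr fun t _ => ?_
  simp [smoothRamp, sub_eq_add_neg]

lemma smoothRamp_nonneg (a b t : ℝ) : 0 ≤ smoothRamp a b t :=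
  mul_nonneg (div_nonneg zero_le_two (smoothHinge_nonneg _)) (smoothHinge_nonneg _)

lemma smoothRamp_of_le {a t : ℝ} (b : ℝ) (h : t ≤ a) : smoothRamp a b t = 0 := by
  rw [smoothRamp, smoothHinge_of_nonpos (sub_nonpos.2 h), mul_zero]

lemma one_lt_smoothRamp {a b t : ℝ} (hab : a < b) (h : b ≤ t) : 1 < smoothRamp a b t := by
  have hp : 0 < smoothHinge (b - a) := smoothHinge_pos (sub_pos.2 hab)
  have hm : smoothHinge (b - a) ≤ smoothHinge (t - a) := monotone_smoothHinge (by linarith)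
  -- The factor `2` in the ramp makes the inequality strict already at `t = b`.
  rw [smoothRamp, div_mul_eq_mul_div, lt_div_iff₀ hp]
  linarith

end Ramp

/-! ### Partial sums and intermediate levels -/

namespace LorentzWeight

variable (w : LorentzWeight)

lemma partialSum_zero : w.partialSum 0 = 0 := by simp [partialSum]

lemma partialSum_succ (k : ℕ) : w.partialSum (k + 1) = w.partialSum k + w.seq k :=
  Finset.sum_range_succ _ _

lemma monotone_partialSum : Monotone w.partialSum :=
  monotone_nat_of_le_succ fun k => by
    rw [partialSum_succ]; linarith [w.pos k]

lemma partialSum_nonneg (k : ℕ) : 0 ≤ w.partialSum k :=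
  Finset.sum_nonneg fun i _ => (w.pos i).le

lemma one_le_partialSum_succ (k : ℕ) : 1 ≤ w.partialSum (k + 1) := by
  have h := w.monotone_partialSum (show 1 ≤ k + 1 by omega)
  simpa [partialSum, w.zero_eq_one] using h

/-- A level strictly between `w.partialSum m` and `w.partialSum (m + 1)`, exceeding the former by
at most `ε`. -/
noncomputable def level (ε : ℝ) (m : ℕ) : ℝ := w.partialSum m + min (w.seq m / 2) ε

lemma partialSum_lt_level {ε : ℝ} (hε : 0 < ε) (m : ℕ) : w.partialSum m < w.level ε m :=
  lt_add_of_pos_right _ (lt_min (half_pos (w.pos m)) hε)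

/-- This strict gap is what local finiteness exploits. -/
lemma level_lt_partialSum_succ (ε : ℝ) (m : ℕ) : w.level ε m < w.partialSum (m + 1) := by
  rw [partialSum_succ, level]
  have := min_le_left (w.seq m / 2) ε
  linarith [w.pos m]

/-- The additive excess `ε` becomes a relative one because nonempty partial sums are at least `w 0 =
1`. -/
lemma level_succ_le {ε : ℝ} (hε : 0 < ε) (k : ℕ) :
    w.level ε (k + 1) ≤ (1 + ε) * w.partialSum (k + 1) := by
  have h1 := min_le_right (w.seq (k + 1) / 2) ε
  have h2 := mul_le_mul_of_nonneg_left (w.one_le_partialSum_succ k) hε.le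
  rw [level]
  linarith

end LorentzWeight

/-! ### Sign patterns and the norm -/

namespace LorentzPredual

variable {w : LorentzWeight} {A : Type*}

/-- Evaluation at a point, as a continuous linear functional. -/
noncomputable def evalCLM (w : LorentzWeight) (a : A) : LorentzPredual w A →L[ℝ] ℝ :=
  LinearMap.mkContinuous
    { toFun := fun y => y.toFun a, map_add' := fun _ _ => rfl, map_smul' := fun _ _ => rfl } 1
    fun y => (y.abs_apply_le_norm a).trans_eq (one_mul _).symm

lemma evalCLM_apply (a : A) (y : LorentzPredual w A) : evalCLM w a y = y.toFun a := rfl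

/-- Finitely supported sign patterns on `A`: the points with sign `1` and those with sign `-1`. -/
abbrev SignPattern (A : Type*) := {i : Finset A × Finset A // Disjoint i.1 i.2}

/-- The number of points in the support of a sign pattern. -/
def SignPattern.size (i : SignPattern A) : ℕ := i.1.1.card + i.1.2.card

/-- The opposite sign pattern. -/
def SignPattern.swap : SignPattern A ≃ SignPattern A where
  toFun i := ⟨(i.1.2, i.1.1), i.2.symm⟩
  invFun i := ⟨(i.1.2, i.1.1), i.2.symm⟩
  left_inv _ := rfl
  right_inv _ := rfl

lemma SignPattern.size_swap (i : SignPattern A) : (SignPattern.swap i).size = i.size :=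
  add_comm _ _

/-- The sum of the values of `y` over the support of a sign pattern, with these signs. -/
noncomputable def signedSum (w : LorentzWeight) (i : SignPattern A) : LorentzPredual w A →L[ℝ] ℝ :=
  ∑ a ∈ i.1.1, evalCLM w a - ∑ a ∈ i.1.2, evalCLM w a

lemma signedSum_apply (i : SignPattern A) (y : LorentzPredual w A) :
    signedSum w i y = ∑ a ∈ i.1.1, y.toFun a - ∑ a ∈ i.1.2, y.toFun a := by
  simp [signedSum, evalCLM_apply]

lemma signedSum_swap (i : SignPattern A) : signedSum w (SignPattern.swap i) = -signedSum w i :=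
  (neg_sub _ _).symm

lemma signedSum_of_size_eq_zero {i : SignPattern A} (h : i.size = 0) (y : LorentzPredual w A) :
    signedSum w i y = 0 := by
  obtain ⟨h1, h2⟩ : i.1.1.card = 0 ∧ i.1.2.card = 0 := by
    simpa only [SignPattern.size, Nat.add_eq_zero_iff] using h
  rw [Finset.card_eq_zero] at h1 h2
  simp [signedSum_apply, h1, h2]

lemma sum_abs_le (y : LorentzPredual w A) {s : Finset A} {k : ℕ} (hs : s.card = k + 1) :
    ∑ a ∈ s, |y.toFun a| ≤ w.partialSum (k + 1) * Lorentz.bar w y.toFun k := by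
  have h : _ ≤ Lorentz.bar w y.toFun k := le_csSup (y.2.1 k) ⟨s, hs, rfl⟩
  rwa [div_le_iff₀' (w.partialSum_succ_pos k)] at h

lemma signedSum_le_bar {i : SignPattern A} {k : ℕ} (hi : i.size = k + 1) (y : LorentzPredual w A) :
    signedSum w i y ≤ w.partialSum (k + 1) * Lorentz.bar w y.toFun k := by
  refine le_trans ?_ (y.sum_abs_le (s := i.1.1.disjUnion i.1.2 i.2) ?_)
  · rw [Finset.sum_disjUnion, signedSum_apply, sub_eq_add_neg, ← Finset.sum_neg_distrib]
    exact add_le_add (Finset.sum_le_sum fun a _ => le_abs_self _)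
      (Finset.sum_le_sum fun a _ => neg_le_abs _)
  · rw [Finset.card_disjUnion]
    exact hi

lemma signedSum_le (i : SignPattern A) (y : LorentzPredual w A) :
    signedSum w i y ≤ w.partialSum i.size * ‖y‖ := by
  rcases h : i.size with _ | k
  · simp [signedSum_of_size_eq_zero h, w.partialSum_zero]
  · exact (signedSum_le_bar h y).trans
      (mul_le_mul_of_nonneg_left (y.bar_le_norm k) (w.partialSum_nonneg _))

lemma exists_signedSum_eq (y : LorentzPredual w A) (s : Finset A) :
    ∃ i : SignPattern A, i.size = s.card ∧ signedSum w i y = ∑ a ∈ s, |y.toFun a| := by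
  classical
  refine ⟨⟨(s.filter fun a => 0 ≤ y.toFun a, s.filter fun a => ¬ 0 ≤ y.toFun a),
    Finset.disjoint_filter_filter_not _ _ _⟩, Finset.card_filter_add_card_filter_not _, ?_⟩
  rw [signedSum_apply, ← Finset.sum_filter_add_sum_filter_not s fun a => 0 ≤ y.toFun a,
    sub_eq_add_neg, ← Finset.sum_neg_distrib]
  congr 1
  · exact Finset.sum_congr rfl fun a ha => (abs_of_nonneg (Finset.mem_filter.1 ha).2).symm
  · exact Finset.sum_congr rfl fun a ha =>
      (abs_of_neg (not_le.1 (Finset.mem_filter.1 ha).2)).symm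

lemma norm_le_of_signedSum_le {y : LorentzPredual w A} {c : ℝ} (hc : 0 ≤ c)
    (h : ∀ i : SignPattern A, i.size ≠ 0 → signedSum w i y ≤ c * w.partialSum i.size) :
    ‖y‖ ≤ c := by
  refine ciSup_le fun k => Real.sSup_le ?_ hc
  rintro r ⟨s, hs, rfl⟩
  obtain ⟨i, hi, hiy⟩ := exists_signedSum_eq y s
  have := h i (by omega)
  rw [hi, hs, hiy] at this
  rwa [div_le_iff₀ (w.partialSum_succ_pos k)]

/-- Elements of `d_*(w, 1, A)` vanish at infinity. -/
lemma finite_setOf_le_abs (y : LorentzPredual w A) {t : ℝ} (ht : 0 < t) :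
    {a | t ≤ |y.toFun a|}.Finite := by
  by_contra hinf
  -- As `w` tends to `0`, so do its Cesàro means; `n` points with `t ≤ |y a|` would force `n * t ≤ W
  -- n * ‖y‖` for every `n`.
  have hces : Tendsto (fun n : ℕ => (n : ℝ)⁻¹ * w.partialSum n * ‖y‖) atTop (𝓝 0) := by
    simpa [LorentzWeight.partialSum] using w.tendsto_zero.cesaro.mul_const ‖y‖
  obtain ⟨n, hn, hn1⟩ := ((hces.eventually_lt_const ht).and (eventually_ge_atTop 1)).exists
  obtain ⟨k, rfl⟩ : ∃ k, n = k + 1 := ⟨n - 1, by omega⟩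
  obtain ⟨s, hs, hcard⟩ := Set.Infinite.exists_subset_card_eq hinf (k + 1)
  have h1 : (k + 1 : ℕ) * t ≤ ∑ a ∈ s, |y.toFun a| := by
    rw [← hcard, ← nsmul_eq_mul]
    exact Finset.card_nsmul_le_sum _ _ _ fun a ha => hs ha
  have h2 := (y.sum_abs_le hcard).trans
    (mul_le_mul_of_nonneg_left (y.bar_le_norm k) (w.partialSum_nonneg _))
  have hpos : (0 : ℝ) < (k + 1 : ℕ) := by positivity
  rw [mul_assoc, inv_mul_lt_iff₀ hpos] at hn
  linarith

/-! ### The smooth ball -/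

/-- The profile of the functional belonging to a sign pattern. -/
noncomputable def profile (w : LorentzWeight) (ε : ℝ) (i : SignPattern A) : ℝ → ℝ :=
  smoothRamp (w.partialSum i.size) (w.level ε i.size)

/-- The unit ball of the smooth norm. -/
def smoothBall (w : LorentzWeight) (A : Type*) (ε : ℝ) : Set (LorentzPredual w A) :=
  sumSublevel (profile w ε) (signedSum w)

lemma signedSum_lt_level {ε : ℝ} (hε : 0 < ε) {y : LorentzPredual w A}
    (hy : y ∈ smoothBall w A ε) (i : SignPattern A) : signedSum w i y < w.level ε i.size := by
  by_contra! h
  have h1 := one_lt_smoothRamp (w.partialSum_lt_level hε i.size) h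
  have h2 := hy {i}
  rw [Finset.sum_singleton, profile] at h2
  linarith

lemma closedBall_subset_smoothBall (w : LorentzWeight) (A : Type*) (ε : ℝ) :
    Metric.closedBall 0 1 ⊆ smoothBall w A ε := by
  intro y hy F
  rw [mem_closedBall_zero_iff] at hy
  rw [Finset.sum_eq_zero fun i _ => ?_]
  · exact zero_le_one
  · exact smoothRamp_of_le _ ((signedSum_le i y).trans
      (mul_le_of_le_one_right (w.partialSum_nonneg _) hy))

lemma smoothBall_subset_closedBall {ε : ℝ} (hε : 0 < ε) :
    smoothBall w A ε ⊆ Metric.closedBall 0 (1 + ε) := by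
  intro y hy
  rw [mem_closedBall_zero_iff]
  refine norm_le_of_signedSum_le (by linarith) fun i hi => ?_
  obtain ⟨k, hk⟩ := Nat.exists_eq_succ_of_ne_zero hi
  have h := (signedSum_lt_level hε hy i).le
  rw [hk] at h ⊢
  exact h.trans (w.level_succ_le hε k)

lemma neg_mem_smoothBall {ε : ℝ} {y : LorentzPredual w A} (hy : y ∈ smoothBall w A ε) :
    -y ∈ smoothBall w A ε := by
  intro F
  refine le_of_eq_of_le ?_ (hy (F.map SignPattern.swap.toEmbedding))
  rw [Finset.sum_map]
  refine Finset.sum_congr rfl fun i _ => ?_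
  simp [profile, SignPattern.size_swap, signedSum_swap]

lemma convex_smoothBall (w : LorentzWeight) (A : Type*) (ε : ℝ) : Convex ℝ (smoothBall w A ε) :=
  convex_sumSublevel fun _ => convexOn_smoothRamp _ _

lemma smoothBall_mem_nhds (w : LorentzWeight) (A : Type*) (ε : ℝ) :
    smoothBall w A ε ∈ 𝓝 (0 : LorentzPredual w A) :=
  mem_of_superset (Metric.closedBall_mem_nhds 0 one_pos) (closedBall_subset_smoothBall w A ε)

lemma balanced_smoothBall (w : LorentzWeight) (A : Type*) (ε : ℝ) :
    Balanced ℝ (smoothBall w A ε) := by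
  rw [balanced_iff_smul_mem]
  intro r hr y hy
  have hstar : ∀ {s : ℝ}, 0 ≤ s → s ≤ 1 → s • y ∈ smoothBall w A ε := fun h0 h1 =>
    (convex_smoothBall w A ε).smul_mem_of_zero_mem
      (mem_of_mem_nhds (smoothBall_mem_nhds w A ε)) hy ⟨h0, h1⟩
  obtain ⟨h1, h2⟩ := abs_le.1 hr
  rcases le_total 0 r with h | h
  · exact hstar h h2
  · have := neg_mem_smoothBall (hstar (neg_nonneg.2 h) (neg_le.1 h1))
    rwa [neg_smul, neg_neg] at this

/-! ### Local finiteness of the profiles -/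

/-- The restriction of a sign pattern to a finite set. -/
def SignPattern.restrict [DecidableEq A] (i : SignPattern A) (T : Finset A) : SignPattern A :=
  ⟨(i.1.1 ∩ T, i.1.2 ∩ T), i.2.mono Finset.inter_subset_left Finset.inter_subset_left⟩

lemma SignPattern.size_restrict_lt [DecidableEq A] {i : SignPattern A} {T : Finset A}
    (h : ¬ (i.1.1 ⊆ T ∧ i.1.2 ⊆ T)) : (i.restrict T).size < i.size := by
  have h1 : (i.1.1 ∩ T).card ≤ i.1.1.card := Finset.card_le_card Finset.inter_subset_left
  have h2 : (i.1.2 ∩ T).card ≤ i.1.2.card := Finset.card_le_card Finset.inter_subset_left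
  have h3 : (i.restrict T).size = (i.1.1 ∩ T).card + (i.1.2 ∩ T).card := rfl
  have h4 : i.size = i.1.1.card + i.1.2.card := rfl
  by_contra! hle
  refine h ⟨?_, ?_⟩
  · exact Finset.inter_eq_left.1 (Finset.eq_of_subset_of_card_le Finset.inter_subset_left (by omega))
  · exact Finset.inter_eq_left.1 (Finset.eq_of_subset_of_card_le Finset.inter_subset_left (by omega))

lemma signedSum_le_restrict [DecidableEq A] (i : SignPattern A) {T : Finset A} {t : ℝ}
    {y : LorentzPredual w A} (ht : 0 ≤ t) (hT : ∀ a ∉ T, |y.toFun a| ≤ t) :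
    signedSum w i y ≤ signedSum w (i.restrict T) y + i.size * t := by
  have key : ∀ s : Finset A, |∑ a ∈ s \ T, y.toFun a| ≤ s.card * t := fun s => by
    calc |∑ a ∈ s \ T, y.toFun a| ≤ ∑ a ∈ s \ T, |y.toFun a| := Finset.abs_sum_le_sum_abs _ _
      _ ≤ (s \ T).card • t :=
        Finset.sum_le_card_nsmul _ _ _ fun a ha => hT a (Finset.mem_sdiff.1 ha).2
      _ = (s \ T).card * t := nsmul_eq_mul _ _
      _ ≤ s.card * t := by
        gcongr
        exact Finset.sdiff_subset
  have h1 := (abs_le.1 (key i.1.1)).2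
  have h2 := (abs_le.1 (key i.1.2)).1
  have e1 := Finset.sum_inter_add_sum_sdiff i.1.1 T y.toFun
  have e2 := Finset.sum_inter_add_sum_sdiff i.1.2 T y.toFun
  have e3 : ((i.size : ℕ) : ℝ) * t = i.1.1.card * t + i.1.2.card * t := by
    rw [SignPattern.size]; push_cast; ring
  rw [signedSum_apply, signedSum_apply, e3]
  simp only [SignPattern.restrict]
  linarith

lemma finite_setOf_support_subset (T : Finset A) :
    {i : SignPattern A | i.1.1 ⊆ T ∧ i.1.2 ⊆ T}.Finite := by
  refine Set.Finite.subset
    ((T.powerset ×ˢ T.powerset).finite_toSet.preimage Subtype.val_injective.injOn) fun i hi => ?_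
  simpa using hi

/-- Near a point of `smoothBall w A ε` only finitely many of the profiles do not vanish. -/
lemma locallyFinite_profile {ε : ℝ} (hε : 0 < ε) {y : LorentzPredual w A}
    (hy : y ∈ smoothBall w A ε) :
    ∃ F : Finset (SignPattern A), ∀ᶠ z in 𝓝 y, ∀ i ∉ F, profile w ε i (signedSum w i z) = 0 := by
  classical
  -- `K` will bound the sizes of active patterns; index `k` of `bar` refers to `k + 1` points.
  obtain ⟨K, hK⟩ := eventually_atTop.1 (y.2.2.eventually_lt_const (half_pos one_pos))
  -- At `t = 0` the inequalities are the gaps between levels and next partial sums; finitely many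
  -- strict ones persist for small `t`.
  obtain ⟨t, ⟨hgap, ht2⟩, ht⟩ : ∃ t : ℝ, ((∀ m ∈ Finset.range (K + 1),
      w.level ε m < (1 - t) * w.partialSum (m + 1) - K * t) ∧ t < 1 / 2) ∧ 0 < t := by
    have h : ∀ᶠ t : ℝ in 𝓝 0, (∀ m ∈ Finset.range (K + 1),
        w.level ε m < (1 - t) * w.partialSum (m + 1) - K * t) ∧ t < 1 / 2 := by
      refine ((Filter.eventually_all_finset _).2 fun m _ => ?_).and (eventually_lt_nhds (by norm_num))
      have hc : ContinuousAt (fun t : ℝ => (1 - t) * w.partialSum (m + 1) - K * t) 0 := by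
        fun_prop
      exact hc.eventually_const_lt (by simpa using w.level_lt_partialSum_succ ε m)
    exact ((h.filter_mono nhdsWithin_le_nhds).and (self_mem_nhdsWithin (s := Set.Ioi 0))).exists
  set T := (y.finite_setOf_le_abs ht).toFinset with hTdef
  have hT : ∀ a ∉ T, |y.toFun a| ≤ t := fun a ha => by
    simp only [hTdef, Set.Finite.mem_toFinset, Set.mem_ofPred_eq, not_le] at ha
    exact ha.le
  refine ⟨(finite_setOf_support_subset T).toFinset, ?_⟩
  filter_upwards [Metric.ball_mem_nhds y ht] with z hz i hi
  rw [Set.Finite.mem_toFinset, Set.mem_ofPred_eq] at hi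
  refine smoothRamp_of_le _ (not_lt.1 fun hlt => ?_)
  rcases hk : i.size with _ | k
  · rw [hk, w.partialSum_zero, signedSum_of_size_eq_zero hk] at hlt
    exact lt_irrefl _ hlt
  -- Moving from `z` to `y` changes the signed sum by at most `t` times the partial sum.
  have hlarge : (1 - t) * w.partialSum (k + 1) < signedSum w i y := by
    have h1 := signedSum_le i (z - y)
    rw [map_sub] at h1
    rw [Metric.mem_ball, dist_eq_norm] at hz
    have h2 := mul_le_mul_of_nonneg_left hz.le (w.partialSum_nonneg i.size)
    rw [hk] at h1 h2 hlt
    linarith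
  have hkK : k < K := by
    by_contra! hle
    have h1 : Lorentz.bar w y.toFun k < 1 / 2 := hK k hle
    have h2 := hlarge.trans_le (signedSum_le_bar hk y)
    rw [mul_comm, mul_lt_mul_iff_right₀ (w.partialSum_succ_pos k)] at h2
    linarith
  -- Restricting to `T` loses at least one point but at most `K * t` of the sum, so the smaller
  -- pattern exceeds its level at `y`.
  have hm := SignPattern.size_restrict_lt hi
  set m := (i.restrict T).size with hmdef
  have h1 := signedSum_le_restrict i ht.le hT
  have h2 := signedSum_lt_level hε hy (i.restrict T)
  have h3 := hgap m (Finset.mem_range.2 (by omega))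
  have h4 : w.partialSum (m + 1) ≤ w.partialSum (k + 1) := w.monotone_partialSum (by omega)
  have h5 := mul_le_mul_of_nonneg_left h4 (show 0 ≤ 1 - t by linarith)
  have h6 : (i.size : ℝ) * t ≤ K * t := by
    gcongr
    omega
  rw [← hmdef] at h2
  linarith

/-! ### The smooth norm and its estimates -/

/-- The smooth norm. -/
noncomputable def smoothNorm (w : LorentzWeight) (A : Type*) (ε : ℝ) :
    Seminorm ℝ (LorentzPredual w A) :=
  gaugeSeminorm (balanced_smoothBall w A ε) (convex_smoothBall w A ε)
    (absorbent_nhds_zero (smoothBall_mem_nhds w A ε))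

lemma smoothNorm_le (ε : ℝ) (x : LorentzPredual w A) : smoothNorm w A ε x ≤ ‖x‖ := by
  have h := mul_gauge_le_norm (x := x)
    (Metric.ball_subset_closedBall.trans (closedBall_subset_smoothBall w A ε))
  rwa [one_mul] at h

lemma le_smoothNorm {ε : ℝ} (hε : 0 < ε) (x : LorentzPredual w A) :
    ‖x‖ / (1 + ε) ≤ smoothNorm w A ε x :=
  le_gauge_of_subset_closedBall (absorbent_nhds_zero (smoothBall_mem_nhds w A ε)) (by linarith)
    (smoothBall_subset_closedBall hε)

lemma isSmoothNorm_smoothNorm {ε : ℝ} (hε : 0 < ε) : IsSmoothNorm (smoothNorm w A ε) := by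
  intro x hx
  refine ContDiffAt.contDiffWithinAt (contDiffAt_gauge_sumSublevel
    (fun _ => convexOn_smoothRamp _ _) (fun _ => contDiff_smoothRamp _ _)
    (fun _ => smoothRamp_nonneg _ _)
    (fun i => smoothRamp_of_le _ (w.partialSum_nonneg _)) (smoothBall_mem_nhds w A ε)
    (fun y hy => locallyFinite_profile hε hy) ?_)
  exact (div_pos (norm_pos_iff.2 hx) (by linarith)).trans_le (le_smoothNorm hε x)

end LorentzPredual

theorem mainTheorem5 (A : Type*) (w : LorentzWeight) (ε : ℝ) (hε : 0 < ε) :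
    ∃ N : Seminorm ℝ (LorentzPredual w A),
      IsEquivalentNorm N ∧ IsSmoothNorm N ∧ EpsApproximates ε N := by
  have hpos : 0 < 1 + ε := by linarith
  refine ⟨LorentzPredual.smoothNorm w A ε, ⟨(1 + ε)⁻¹, 1, inv_pos.2 hpos, one_pos, fun x => ?_⟩,
    LorentzPredual.isSmoothNorm_smoothNorm hε, fun x => ?_⟩
  · rw [one_mul, inv_mul_eq_div]
    exact ⟨LorentzPredual.le_smoothNorm hε x, LorentzPredual.smoothNorm_le ε x⟩
  · have h1 := LorentzPredual.le_smoothNorm hε x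
    have h2 := LorentzPredual.smoothNorm_le ε x
    refine ⟨le_trans ?_ h1, h2.trans (le_mul_of_one_le_left (norm_nonneg x) (by linarith))⟩
    rw [le_div_iff₀ hpos]
    -- The lower bound is `(1 - ε) * (1 + ε) = 1 - ε ^ 2 ≤ 1`.
    have := mul_nonneg (sq_nonneg ε) (norm_nonneg x)
    linarith
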